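/- Let $\mathbb{N}=\{1,2,3,\dots\}$ and $\omega=\mathbb{N}\cup\{0\}$. For a discrete set $S$, let $\beta S$ be its Stone–Čech compactification, whose points are the ultrafilters on $S$; regard $\beta\mathbb{N}$ as the subset $\{p\in\beta\omega:\mathbb{N}\in p\}$ of $\beta\omega$. For real $\alpha>0$ and $0<\gamma<1$ let $g_{\alpha,\gamma}:\mathbb{N}\to\omega$, $g_{\alpha,\gamma}(n)=\lfloor \alpha n+\gamma\rfloor$, and let $\widetilde{g_{\alpha,\gamma}}:\beta\mathbb{N}\to\beta\omega$ be its continuous extension. For a collection $\mathcal{F}$ of subsets of $\mathbb{N}$ let $$\beta(\mathcal{F})=\{p\in\beta\mathbb{N}:p\subseteq\mathcal{F}\},\qquad \mathcal{F}^{\star}=\{E\subseteq\mathbb{N}: E\cap A\neq\emptyset\text{ for all }A\in\mathcal{F}\}.$$ Consider the following seven collections of subsets $A$ of $\mathbb{N}$: - $\mathcal{IF}$: $A$ is infinite; - $\mathcal{AP}$: $A$ contains arithmetic progressions (with positive common difference) of every finite length; - $\mathcal{PS}$: $A$ is piecewise syndetic, i.e. there is a finite nonempty $G\subseteq\mathbb{N}$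 such that for every finite nonempty $F\subseteq\mathbb{N}$ there is $x\in\mathbb{N}$ with $F+x\subseteq\bigcup_{t\in G}(-t+A)$, where $-t+A=\{s\in\mathbb{N}:t+s\in A\}$; - $\mathcal{HSD}$: $\sum_{n\in A}\frac1n=\infty$; - $\mathcal{J}$: $A$ is a $J$-set, i.e. for every finite nonempty set $F$ of sequences $f:\mathbb{N}\to\mathbb{N}$ there are $a\in\mathbb{N}$ and a finite nonempty $H\subseteq\mathbb{N}$ with $a+\sum_{n\in H}f(n)\in A$ for all $f\in F$; - $\mathcal{PUAD}$: $\limsup_{n\to\infty}\frac{|A\cap\{1,\dots,n\}|}{n}>0$; - $\mathcal{PUBD}$: $\limsup_{m-n\to\infty}\frac{|A\cap\{n+1,\dots,m\}|}{m-n}>0$. Let $0<\alpha\le 1$ and $0<\gamma<1$, and let $\mathcal{F}$ be any of $\mathcal{IF},\mathcal{AP},\mathcal{PS},\mathcal{HSD},\mathcal{J},\mathcal{PUAD},\mathcal{PUBD}$. Then $$\widetilde{g_{\alpha,\gamma}}[\beta(\mathcal{F})]=\beta(\mathcal{F}),$$ and for every $E\in\mathcal{F}^{\star}$ one has $g_{\alpha,\gamma}[E]\cap\mathbb{N}\in\mathcal{F}^{\star}$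 (that is, $g_{\alpha,\gamma}[\mathcal{F}^{\star}]\subseteq\mathcal{F}^{\star}$). -/

import Mathlib

open scoped ENNReal

/-! Throughout, `ℕ+ = {1, 2, 3, …}` and `ℕ = {0, 1, 2, …}`.  The points of the Stone–Čech
compactification of a discrete set `S` are the ultrafilters on `S`; Mathlib's topology on
`Ultrafilter S` is the usual one, with the sets `{p | A ∈ p}` as a basis. -/

namespace NonhomSpectra

/-- The function `n ↦ ⌊α n + γ⌋` on the positive integers.  For `α, γ > 0` its values are
nonnegative integers, and `0` is a possible value (for small `n`, when `α + γ < 1`). -/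
noncomputable def g (α γ : ℝ) (n : ℕ+) : ℕ := ⌊α * (n : ℝ) + γ⌋₊

/-- The continuous extension of `n ↦ ⌊α n + γ⌋` to the Stone–Čech compactification:
`A` belongs to the image of `p` iff `{n | ⌊α n + γ⌋ ∈ A}` belongs to `p`. -/
noncomputable def gTilde (α γ : ℝ) : Ultrafilter ℕ+ → Ultrafilter ℕ :=
  Ultrafilter.map (g α γ)

/-- The inclusion of the Stone–Čech compactification of the positive integers in that of the
nonnegative integers, i.e. the continuous extension of the inclusion `ℕ+ → ℕ`. -/
def incl : Ultrafilter ℕ+ → Ultrafilter ℕ := Ultrafilter.map (fun n : ℕ+ => (n : ℕ))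

/-- `A` is infinite. -/
def IF : Set (Set ℕ+) := {A | A.Infinite}

/-- `A` contains arithmetic progressions `a, a + d, …, a + (k - 1) d` of every length `k`. -/
def AP : Set (Set ℕ+) :=
  {A | ∀ k : ℕ, ∃ a d : ℕ+, ∀ i < k, ∃ x ∈ A, (x : ℕ) = a + i * d}

/-- `A` is piecewise syndetic in `(ℕ+, +)`: for some finite nonempty `G`, every finite nonempty `F`
has a translate `F + x` inside `⋃ t ∈ G, (-t + A)`, where `-t + A = {s | t + s ∈ A}`. -/
def PS : Set (Set ℕ+) :=
  {A | ∃ G : Finset ℕ+, G.Nonempty ∧ ∀ F : Finset ℕ+, F.Nonempty →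
    ∃ x : ℕ+, ∀ y ∈ F, y + x ∈ ⋃ t ∈ G, {s : ℕ+ | t + s ∈ A}}

/-- The harmonic sum `∑ n ∈ A, 1 / n` diverges. -/
def HSD : Set (Set ℕ+) := {A | ∑' n : A, ((n : ℕ+) : ℝ≥0∞)⁻¹ = ∞}

/-- `A` is a J-set in `(ℕ+, +)`: for every finite nonempty set `F` of sequences in `ℕ+` there are
`a ∈ ℕ+` and a finite nonempty `H ⊆ ℕ+` with `a + ∑ n ∈ H, f n ∈ A` for all `f ∈ F`.
(The sum is formed in `ℕ`, as `ℕ+` has no zero.) -/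
def J : Set (Set ℕ+) :=
  {A | ∀ F : Finset (ℕ+ → ℕ+), F.Nonempty → ∃ (a : ℕ+) (H : Finset ℕ+), H.Nonempty ∧
    ∀ f ∈ F, ∃ x ∈ A, (x : ℕ) = a + ∑ n ∈ H, (f n : ℕ)}

/-- The upper asymptotic density `limsup_{n → ∞} |A ∩ {1, …, n}| / n`. -/
noncomputable def upperDensity (A : Set ℕ+) : ℝ :=
  Filter.limsup (fun n : ℕ+ => ((A ∩ Set.Icc 1 n).ncard : ℝ) / (n : ℝ)) Filter.atTop

/-- The upper Banach density `limsup_{m - n → ∞} |A ∩ {n + 1, …, m}| / (m - n)`;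
a pair `q` stands for `(n, m)`. -/
noncomputable def upperBanachDensity (A : Set ℕ+) : ℝ :=
  Filter.limsup
    (fun q : ℕ+ × ℕ+ => ((A ∩ Set.Ioc q.1 q.2).ncard : ℝ) / ((q.2 : ℝ) - (q.1 : ℝ)))
    (Filter.comap (fun q : ℕ+ × ℕ+ => (q.2 : ℝ) - (q.1 : ℝ)) Filter.atTop)

/-- `A` has positive upper asymptotic density. -/
def PUAD : Set (Set ℕ+) := {A | 0 < upperDensity A}

/-- `A` has positive upper Banach density. -/
def PUBD : Set (Set ℕ+) := {A | 0 < upperBanachDensity A}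

/-- `β(𝓕)`: the ultrafilters all of whose members belong to `𝓕`. -/
def beta (𝓕 : Set (Set ℕ+)) : Set (Ultrafilter ℕ+) := {p | ∀ A ∈ p, A ∈ 𝓕}

/-- The dual `𝓕*`: the sets that meet every member of `𝓕`. -/
def dual (𝓕 : Set (Set ℕ+)) : Set (Set ℕ+) := {E | ∀ A ∈ 𝓕, (E ∩ A).Nonempty}

/-- The map induced on ultrafilters is continuous. -/
theorem continuous_ultrafilter_map {S T : Type*} (f : S → T) :
    Continuous (Ultrafilter.map f) := by
  rw [continuous_generateFrom_iff]
  rintro _ ⟨A, rfl⟩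
  exact ultrafilter_isOpen_basic (f ⁻¹' A)

/-- `gTilde` is the continuous extension of `g`. -/
theorem gTilde_continuous_extension (α γ : ℝ) :
    Continuous (gTilde α γ) ∧ ∀ n : ℕ+, gTilde α γ (pure n) = pure (g α γ n) :=
  ⟨continuous_ultrafilter_map _, fun n => Ultrafilter.map_pure _ n⟩

/-- `incl` is an injective continuous extension of the inclusion. -/
theorem incl_continuous_extension :
    Continuous incl ∧ Function.Injective incl ∧ ∀ n : ℕ+, incl (pure n) = pure (n : ℕ) :=
  by
  refine ⟨continuous_ultrafilter_map _, fun p q h => ?_, fun n => Ultrafilter.map_pure _ n⟩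
  ext A
  have hA : (fun n : ℕ+ => (n : ℕ)) ⁻¹' ((fun n : ℕ+ => (n : ℕ)) '' A) = A :=
    Set.preimage_image_eq A PNat.coe_injective
  have key : ∀ r : Ultrafilter ℕ+, (fun n : ℕ+ => (n : ℕ)) '' A ∈ incl r ↔ A ∈ r := fun r => by
    rw [incl, Ultrafilter.mem_map, hA]
  rw [← key p, ← key q, h]

end NonhomSpectra

namespace NonhomSpectra

/-! All seven families are stable under coarse dilation (`mem_of_near`): if every point of `β A`
lies within a fixed distance of `B`, then `A ∈ 𝓕` forces `B ∈ 𝓕`. The map `g` is within 1 of `n ↦ α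
n`, and since `α ≤ 1` it has a right inverse `sect`, at bounded distance from `m ↦ m / α`. Pushing
ultrafilters forward by `g` and by `sect` therefore gives the two inclusions; the value 0 does no
harm because `{1} ∉ 𝓕`. For the dual, `g⁻¹(B)` contains `sect B`, so it lies in `𝓕` whenever `B`
does, and hence meets `E`.

Stability is a matter of counting or of bounded gaps except for `AP` and `J`, where exact additive
structure must survive a bounded error. There Hales–Jewett makes the error nearly constant on a
combinatorial line, and Diophantine approximation brings the dilated increments close to the desired
integers. Integers that differ by less than 1 are equal, so the structure is exact. -/

variable {A B : Set ℕ+} {β C : ℝ}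

/-! ### Bounded fibres: infinite, piecewise syndetic and harmonically large sets -/

/-- The number of positive integers `x` with `β x` within `C` of a given point is bounded. -/
theorem card_le_of_abs_sub_le (hβ : 0 < β) (y : ℝ) (s : Finset ℕ+)
    (hs : ∀ x ∈ s, |y - β * x| ≤ C) : s.card ≤ ⌊2 * C / β⌋₊ + 1 := by
  rcases s.eq_empty_or_nonempty with rfl | hne
  · simp
  set a := s.min' hne
  have hsub : s.map ⟨((↑) : ℕ+ → ℕ), PNat.coe_injective⟩ ⊆
      Finset.Icc (a : ℕ) (a + ⌊2 * C / β⌋₊) := by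
    intro n hn
    obtain ⟨x, hx, rfl⟩ := Finset.mem_map.1 hn
    have hax : a ≤ x := s.min'_le x hx
    have hax' : (a : ℕ) ≤ x := hax
    have h1 := abs_le.1 (hs x hx)
    have h2 := abs_le.1 (hs a (s.min'_mem hne))
    have h3 : (x : ℕ) - (a : ℕ) ≤ ⌊2 * C / β⌋₊ := by
      apply Nat.le_floor
      rw [Nat.cast_sub hax', le_div_iff₀ hβ]
      nlinarith
    simp only [Function.Embedding.coeFn_mk, Finset.mem_Icc]
    omega
  have := Finset.card_le_card hsub
  rw [Finset.card_map, Nat.card_Icc] at this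
  omega

theorem card_le_mul_card_image_of_abs_sub_le (hβ : 0 < β) {h : ℕ+ → ℕ+} (s : Finset ℕ+)
    (hs : ∀ x ∈ s, |((h x : ℕ+) : ℝ) - β * x| ≤ C) :
    s.card ≤ (⌊2 * C / β⌋₊ + 1) * (s.image h).card := by
  refine Finset.card_le_mul_card_image s _ fun y _ => ?_
  refine card_le_of_abs_sub_le hβ (y : ℝ) _ fun x hx => ?_
  obtain ⟨hxs, rfl⟩ := Finset.mem_filter.1 hx
  exact hs x hxs

theorem IF_of_near (hβ : 0 < β) (hA : A ∈ IF)
    (h : ∀ x ∈ A, ∃ y ∈ B, |(y : ℝ) - β * x| ≤ C) : B ∈ IF := by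
  choose! h hB hd using h
  intro hfin
  obtain ⟨s, hs, hcard⟩ := Set.Infinite.exists_subset_card_eq hA
    ((⌊2 * C / β⌋₊ + 1) * hfin.toFinset.card + 1)
  have h1 := card_le_mul_card_image_of_abs_sub_le hβ s fun x hx => hd x (hs hx)
  have h2 : (s.image h).card ≤ hfin.toFinset.card := by
    refine Finset.card_le_card fun y hy => ?_
    obtain ⟨x, hx, rfl⟩ := Finset.mem_image.1 hy
    exact hfin.mem_toFinset.2 (hB x (hs hx))
  have := Nat.mul_le_mul_left (⌊2 * C / β⌋₊ + 1) h2
  omega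

theorem PS_of_near (hβ : 0 < β) (hC : 0 ≤ C) (hA : A ∈ PS)
    (h : ∀ x ∈ A, ∃ y ∈ B, |(y : ℝ) - β * x| ≤ C) : B ∈ PS := by
  obtain ⟨G, -, hG⟩ := hA
  obtain ⟨b, hb⟩ : ∃ b : ℕ+, ∀ t ∈ G, t ≤ b := G.exists_le
  set K : ℕ+ := ⟨⌈2 * C + 2 * β + β * b + 1⌉₊, Nat.ceil_pos.2 (by positivity)⟩
  refine ⟨Finset.Icc 1 K, ⟨1, by simp⟩, fun F _ => ?_⟩
  obtain ⟨N, hN⟩ : ∃ N : ℕ+, ∀ t ∈ F, t ≤ N := F.exists_le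
  set M : ℕ+ := ⟨⌈(N + 1 + C) / β⌉₊ + 1, Nat.succ_pos _⟩
  obtain ⟨x, hx⟩ := hG (Finset.Icc 1 M) ⟨1, by simp⟩
  have hβx : 0 < β * x := mul_pos hβ (by exact_mod_cast x.pos)
  set x' : ℕ+ := ⟨⌈β * x⌉₊, Nat.ceil_pos.2 hβx⟩
  have hx'1 : β * x ≤ (x' : ℝ) := Nat.le_ceil _
  have hx'2 : (x' : ℝ) < β * x + 1 := Nat.ceil_lt_add_one hβx.le
  refine ⟨x', fun y' hy' => ?_⟩
  have hyN : (y' : ℝ) ≤ N := by exact_mod_cast hN y' hy'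
  -- Solves `β (u + x) - C = y' + x'`: rounding `u` up to `y` puts the point of `B` near `β (t + y +
  -- x)` strictly beyond `y' + x'`, by at most `K`, which does not depend on `F`.
  set u : ℝ := (y' + x' - β * x + C) / β
  have hu0 : 0 ≤ u := div_nonneg (by
    have : (0 : ℝ) < y' := by exact_mod_cast y'.pos
    linarith) hβ.le
  set y : ℕ+ := ⟨⌈u⌉₊ + 1, Nat.succ_pos _⟩
  have hyc : (y : ℝ) = ⌈u⌉₊ + 1 := by simp [y]
  have hy1 : u + 1 ≤ y := by rw [hyc]; linarith [Nat.le_ceil u]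
  have hy2 : (y : ℝ) < u + 2 := by rw [hyc]; linarith [Nat.ceil_lt_add_one hu0]
  have hβu : β * u = y' + x' - β * x + C := mul_div_cancel₀ _ hβ.ne'
  have hyM : y ≤ M := by
    refine PNat.coe_le_coe _ _ |>.1 (Nat.succ_le_succ (Nat.ceil_mono ?_))
    exact div_le_div_of_nonneg_right (by linarith) hβ.le
  have hmem := hx y (Finset.mem_Icc.2 ⟨one_le, hyM⟩)
  simp only [Set.mem_iUnion, Set.mem_ofPred_eq, exists_prop] at hmem
  obtain ⟨t, htG, htA⟩ := hmem
  obtain ⟨z, hzB, hz⟩ := h _ htA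
  have htb : (t : ℝ) ≤ b := by exact_mod_cast hb t htG
  have ht0 : (0 : ℝ) < t := by exact_mod_cast t.pos
  rw [abs_le] at hz
  push_cast at hz
  have e1 := mul_le_mul_of_nonneg_left hy1 hβ.le
  have e2 := mul_le_mul_of_nonneg_left hy2.le hβ.le
  have e3 := mul_le_mul_of_nonneg_left htb hβ.le
  have e4 := mul_pos hβ ht0
  have hlt : y' + x' < z := by
    have : ((y' : ℝ) + x') < z := by linarith
    exact_mod_cast this
  simp only [Set.mem_iUnion, Set.mem_ofPred_eq, exists_prop]
  refine ⟨z - (y' + x'), Finset.mem_Icc.2 ⟨one_le, ?_⟩, ?_⟩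
  · refine PNat.coe_le_coe _ _ |>.1 ?_
    rw [PNat.sub_coe, if_pos hlt]
    have h5 : (z : ℝ) ≤ (y' + x') + K := by
      have : 2 * C + 2 * β + β * b + 1 ≤ (K : ℝ) := Nat.le_ceil _
      linarith
    have h6 : (z : ℕ) ≤ ((y' + x' : ℕ+) : ℕ) + K := by
      rw [PNat.add_coe]; exact_mod_cast h5
    omega
  · rw [add_comm (z - _), PNat.add_sub_of_lt hlt]
    exact hzB

/-- Since `h x ≤ (β + C) x`, the weight of `x` is at most a constant times that of `h x`, and each
point of `B` is hit at most `K` times. -/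
theorem HSD_of_near (hβ : 0 < β) (hC : 0 ≤ C) (hA : A ∈ HSD)
    (h : ∀ x ∈ A, ∃ y ∈ B, |(y : ℝ) - β * x| ≤ C) : B ∈ HSD := by
  choose! h hB hd using h
  set D : ℕ := ⌈β + C⌉₊
  set K : ℕ := ⌊2 * C / β⌋₊ + 1
  have hbd : ∀ x : A, (((x : ℕ+) : ℕ) : ℝ≥0∞)⁻¹ ≤ D * (((h x : ℕ+) : ℕ) : ℝ≥0∞)⁻¹ := by
    intro x
    have hx1 : (1 : ℝ) ≤ (x : ℕ+) := by exact_mod_cast (x : ℕ+).pos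
    have h1 : ((h x : ℕ+) : ℝ) ≤ D * (x : ℕ+) := by
      have := (abs_le.1 (hd x x.2)).2
      have hD : β + C ≤ D := Nat.le_ceil _
      nlinarith
    have h2 : (((h x : ℕ+) : ℕ) : ℝ≥0∞) ≤ D * ((x : ℕ+) : ℕ) := by exact_mod_cast h1
    have hx0 : (((x : ℕ+) : ℕ) : ℝ≥0∞) ≠ 0 := by simp
    have hh0 : (((h x : ℕ+) : ℕ) : ℝ≥0∞) ≠ 0 := by simp
    rw [← div_eq_mul_inv, ENNReal.le_div_iff_mul_le (Or.inl hh0) (Or.inl (by simp)), mul_comm,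
      ← div_eq_mul_inv]
    exact ENNReal.div_le_of_le_mul h2
  have hfib : ∑' x : A, (((h x : ℕ+) : ℕ) : ℝ≥0∞)⁻¹ ≤
      K * ∑' y : B, (((y : ℕ+) : ℕ) : ℝ≥0∞)⁻¹ := by
    rw [ENNReal.tsum_eq_iSup_sum]
    refine iSup_le fun s => ?_
    classical
    let h' : A → B := fun x => ⟨h x, hB x x.2⟩
    calc ∑ x ∈ s, (((h x : ℕ+) : ℕ) : ℝ≥0∞)⁻¹
        = ∑ y ∈ s.image h', (s.filter fun x => h' x = y).card • (((y : ℕ+) : ℕ) : ℝ≥0∞)⁻¹ :=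
          Finset.sum_comp (fun y : B => (((y : ℕ+) : ℕ) : ℝ≥0∞)⁻¹) h'
      _ ≤ ∑ y ∈ s.image h', K * (((y : ℕ+) : ℕ) : ℝ≥0∞)⁻¹ := by
          refine Finset.sum_le_sum fun y _ => ?_
          rw [nsmul_eq_mul]
          gcongr
          rw [← Finset.card_map (Function.Embedding.subtype (· ∈ A))]
          refine card_le_of_abs_sub_le hβ ((y : ℕ+) : ℝ) _ fun x hx => ?_
          obtain ⟨x, hx', rfl⟩ := Finset.mem_map.1 hx
          obtain ⟨-, rfl⟩ := Finset.mem_filter.1 hx'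
          exact hd x x.2
      _ ≤ K * ∑' y : B, (((y : ℕ+) : ℕ) : ℝ≥0∞)⁻¹ := by
          rw [← Finset.mul_sum]
          gcongr
          exact ENNReal.sum_le_tsum _
  by_contra hfin
  have hfin' : ∑' y : B, (((y : ℕ+) : ℕ) : ℝ≥0∞)⁻¹ < ∞ := lt_top_iff_ne_top.2 hfin
  refine absurd hA (ne_of_lt (α := ℝ≥0∞) ?_)
  calc ∑' x : A, (((x : ℕ+) : ℕ) : ℝ≥0∞)⁻¹
      ≤ ∑' x : A, D * (((h x : ℕ+) : ℕ) : ℝ≥0∞)⁻¹ := ENNReal.tsum_le_tsum hbd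
    _ ≤ D * (K * ∑' y : B, (((y : ℕ+) : ℕ) : ℝ≥0∞)⁻¹) := by
        rw [ENNReal.tsum_mul_left]; gcongr
    _ < ∞ := ENNReal.mul_lt_top (by simp) (ENNReal.mul_lt_top (by simp) hfin')

/-! ### Hales–Jewett lines and arithmetic progressions -/

/-- Hales–Jewett for bounded real-valued functions: some line has small oscillation. -/
theorem exists_line_oscillation_lt (α : Type) [Finite α] (C : ℝ) :
    ∃ (ι : Type) (_ : Fintype ι), ∀ e : (ι → α) → ℝ, (∀ w, |e w| ≤ C) →
      ∃ l : Combinatorics.Line α ι, ∀ a b, |e (l a) - e (l b)| < 1 / 4 := by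
  obtain ⟨ι, hι, H⟩ := Combinatorics.Line.exists_mono_in_high_dimension α
    (Set.Icc ⌊4 * -C⌋ ⌊4 * C⌋)
  refine ⟨ι, hι, fun e he => ?_⟩
  obtain ⟨l, c, hc⟩ := H fun w => ⟨⌊4 * e w⌋, Int.floor_mono (by linarith [abs_le.1 (he w)]),
    Int.floor_mono (by linarith [abs_le.1 (he w)])⟩
  refine ⟨l, fun a b => ?_⟩
  have h1 : ⌊4 * e (l a)⌋ = ⌊4 * e (l b)⌋ := congrArg Subtype.val ((hc a).trans (hc b).symm)
  have h2 := abs_lt.1 (Int.abs_sub_lt_one_of_floor_eq_floor h1)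
  rw [abs_lt]
  constructor <;> linarith

/-- The set of moving coordinates of a line. -/
def activeCoords {α ι : Type} [Fintype ι] [DecidableEq α] (l : Combinatorics.Line α ι) :
    Finset ι := Finset.univ.filter fun i => l.idxFun i = none

theorem activeCoords_nonempty {α ι : Type} [Fintype ι] [DecidableEq α]
    (l : Combinatorics.Line α ι) : (activeCoords l).Nonempty := by
  obtain ⟨i, hi⟩ := l.proper
  exact ⟨i, by simp [activeCoords, hi]⟩

/-- Fixed coordinates of the line contribute the same amount for every letter; only moving ones see
`a`. -/
theorem exists_sum_line_eq {α ι : Type} [Fintype ι] [DecidableEq α] [Nonempty α]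
    (l : Combinatorics.Line α ι) (φ : ι → α → ℕ) :
    ∃ c : ℕ, ∀ a, ∑ i, φ i (l a i) = c + ∑ i ∈ activeCoords l, φ i a := by
  obtain ⟨a₀⟩ := ‹Nonempty α›
  refine ⟨∑ i with ¬ l.idxFun i = none, φ i (l a₀ i), fun a => ?_⟩
  rw [← Finset.sum_filter_add_sum_filter_not Finset.univ fun i => l.idxFun i = none, add_comm]
  congr 1
  · refine Finset.sum_congr rfl fun i hi => ?_
    obtain ⟨b, hb⟩ := Option.ne_none_iff_exists'.1 (Finset.mem_filter.1 hi).2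
    simp [hb]
  · refine Finset.sum_congr rfl fun i hi => ?_
    simp [(Finset.mem_filter.1 hi).2]

theorem AP_of_near (hβ : 0 < β) (hA : A ∈ AP)
    (h : ∀ x ∈ A, ∃ y ∈ B, |(y : ℝ) - β * x| ≤ C) : B ∈ AP := by
  choose! h hB hd using h
  intro k
  rcases k.eq_zero_or_pos with rfl | hk
  · exact ⟨1, 1, by simp⟩
  have : NeZero k := ⟨hk.ne'⟩
  obtain ⟨ι, _, hι⟩ := exists_line_oscillation_lt (Fin k) C
  obtain ⟨D, hD⟩ := exists_nat_gt (1 / β)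
  have hD0 : 0 < D := by exact_mod_cast (one_div_pos.2 hβ).trans hD
  have hβD : 1 < β * D := by rwa [div_lt_iff₀' hβ] at hD
  set c := Fintype.card ι
  -- Large enough that the Dirichlet error `1 / (N + 1)`, multiplied by at most `c * k`, stays below
  -- 1/4.
  set N := 4 * (k * (c + 1))
  obtain ⟨a, d, had⟩ := hA (D * N * (c * k) + 1)
  -- Dirichlet: `t` makes `β` times the step `D * t * d` close to the integer `j`. The factor `D`,
  -- with `β D > 1`, forces `j > 0`.
  obtain ⟨j, t, ht0, htN, htj⟩ :=
    Real.exists_int_int_abs_mul_sub_le (β * d * D) (n := N) (by positivity)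
  lift t to ℕ using ht0.le
  norm_cast at ht0 htN
  have hx : ∀ w : ι → Fin k, ∃ x ∈ A, (x : ℕ) = a + D * t * (∑ i, (w i : ℕ)) * d := by
    intro w
    apply had
    have : ∑ i, (w i : ℕ) ≤ c * k := by
      rw [← smul_eq_mul]
      exact Finset.sum_le_card_nsmul _ _ _ fun i _ => (w i).2.le
    calc D * t * (∑ i, (w i : ℕ)) ≤ D * N * (c * k) := by gcongr
      _ < _ := Nat.lt_succ_self _
  choose x hxA hx using hx
  obtain ⟨l, hl⟩ := hι (fun w => (h (x w) : ℝ) - β * x w) fun w => hd _ (hxA w)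
  obtain ⟨s, hs⟩ := exists_sum_line_eq l fun _ v => (v : ℕ)
  set r := (activeCoords l).card
  have hr0 : 0 < r := Finset.card_pos.2 (activeCoords_nonempty l)
  have hrc : r ≤ c := Finset.card_le_univ _
  have hN : (N : ℝ) = 4 * (k * (c + 1)) := by simp [N]
  have hk' : (1 : ℝ) ≤ k := by exact_mod_cast hk
  have hj0 : 0 < j := by
    have h1 : (1 : ℝ) ≤ t := by exact_mod_cast ht0
    have h2 : (1 : ℝ) ≤ d := by exact_mod_cast d.pos
    have h3 : 1 / ((N : ℝ) + 1) ≤ 1 := by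
      rw [div_le_one (by positivity)]; linarith [Nat.cast_nonneg (α := ℝ) N]
    have h4 : 1 < (t : ℝ) * (β * d * D) := by
      have : 1 < (t * d : ℝ) * (β * D) := one_lt_mul (by nlinarith) hβD
      linarith
    have h5 := (abs_le.1 htj).2
    push_cast at h5
    have : (0 : ℝ) < j := by linarith
    exact_mod_cast this
  lift j to ℕ using hj0.le
  norm_cast at hj0
  refine ⟨h (x (l 0)), ⟨j * r, by positivity⟩, fun i hi => ⟨h (x (l ⟨i, hi⟩)), hB _ (hxA _), ?_⟩⟩
  have e1 := abs_lt.1 (hl ⟨i, hi⟩ 0)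
  have e2 : ((x (l ⟨i, hi⟩) : ℕ) : ℝ) = a + D * t * (s + r * i) * d := by
    rw [hx, hs]; push_cast [Finset.sum_const, smul_eq_mul, r]; ring
  have e3 : ((x (l 0) : ℕ) : ℝ) = a + D * t * s * d := by
    rw [hx, hs]; push_cast [Finset.sum_const, smul_eq_mul, r]; simp
  have e4 : |(r * i : ℝ) * (t * (β * d * D) - j)| ≤ 1 / 4 := by
    rw [abs_mul, abs_of_nonneg (by positivity)]
    push_cast at htj
    calc (r * i : ℝ) * |t * (β * d * D) - j| ≤ (c * k) * (1 / (N + 1)) := by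
          gcongr
      _ ≤ 1 / 4 := by
          rw [mul_one_div, div_le_div_iff₀ (by positivity) (by norm_num), hN]
          nlinarith
  have e5 := abs_le.1 e4
  rw [e2, e3] at e1
  -- Oscillation along the line and Diophantine error each cost at most 1/4.
  have key : |((h (x (l ⟨i, hi⟩)) : ℕ) : ℝ) - (h (x (l 0)) + i * (j * r))| < 1 := by
    rw [abs_lt]
    constructor <;> nlinarith
  have key' : |((h (x (l ⟨i, hi⟩)) : ℕ) : ℤ) - ((h (x (l 0)) : ℕ) + i * (j * r))| < 1 := by
    exact_mod_cast key
  have := Int.abs_lt_one_iff.1 key'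
  simp only [PNat.mk_coe]
  zify
  linarith

/-! ### Block sums near multiples of `β`, and J-sets -/

/-- Simultaneous Diophantine approximation by sums over a block of indices. -/
theorem exists_block_sum_near (hβ : 0 < β) (F : Finset (ℕ+ → ℕ+)) (M : ℕ+) {δ : ℝ}
    (hδ : 0 < δ) (hδ' : δ < 1) :
    ∃ (M' : ℕ+) (H : Finset ℕ+), H.Nonempty ∧ H ⊆ Finset.Ioc M M' ∧
      ∀ f ∈ F, ∃ m : ℕ+, |(∑ n ∈ H, (f n : ℝ)) - β * m| ≤ δ := by
  obtain ⟨Q, hQ⟩ := exists_nat_gt (β / δ)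
  have hQ0 : (0 : ℝ) < Q := (div_pos hβ hδ).trans hQ
  let u : F → ℕ+ → ℝ := fun f k => (∑ n ∈ Finset.Iic (M + k), ((f : ℕ+ → ℕ+) n : ℝ)) / β
  let c : ℕ+ → F → Set.Icc (0 : ℤ) Q := fun k f => ⟨⌊Q * Int.fract (u f k)⌋,
    Int.floor_nonneg.2 (mul_nonneg hQ0.le (Int.fract_nonneg _)), by
      have : Q * Int.fract (u f k) ≤ Q := by
        nlinarith [Int.fract_lt_one (u f k)]
      have := Int.floor_mono this
      simpa using this⟩
  -- Pigeonhole on the fractional parts of the partial sums over `β`, cut into cells of width `1 / Q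
  -- < δ / β`, for all `f ∈ F` at once.
  obtain ⟨k, k', hne, hc⟩ := Finite.exists_ne_map_eq_of_infinite c
  wlog hlt : k < k' generalizing k k'
  · exact this k' k hne.symm hc.symm (lt_of_le_of_ne (not_lt.1 hlt) hne.symm)
  have hss : Finset.Iic (M + k) ⊆ Finset.Iic (M + k') :=
    Finset.Iic_subset_Iic.2 (by gcongr)
  refine ⟨M + k', Finset.Iic (M + k') \ Finset.Iic (M + k), ⟨M + k', ?_⟩, ?_, fun f hf => ?_⟩
  · simp [hlt]
  · intro n hn
    simp only [Finset.mem_sdiff, Finset.mem_Iic, not_le] at hn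
    exact Finset.mem_Ioc.2 ⟨lt_trans (PNat.lt_add_right M k) hn.2, hn.1⟩
  have h1 : ⌊Q * Int.fract (u ⟨f, hf⟩ k)⌋ = ⌊Q * Int.fract (u ⟨f, hf⟩ k')⌋ :=
    congrArg Subtype.val (congrFun hc ⟨f, hf⟩)
  have h2 := abs_lt.1 (Int.abs_sub_lt_one_of_floor_eq_floor h1)
  set S := ∑ n ∈ Finset.Iic (M + k') \ Finset.Iic (M + k), (f n : ℝ)
  have hS : β * u ⟨f, hf⟩ k' - β * u ⟨f, hf⟩ k = S := by
    simp only [u]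
    rw [mul_div_cancel₀ _ hβ.ne', mul_div_cancel₀ _ hβ.ne', sub_eq_iff_eq_add]
    exact (Finset.sum_sdiff hss).symm
  set m : ℤ := ⌊u ⟨f, hf⟩ k'⌋ - ⌊u ⟨f, hf⟩ k⌋
  have hm : S - β * m = β * (Int.fract (u ⟨f, hf⟩ k') - Int.fract (u ⟨f, hf⟩ k)) := by
    rw [← hS, ← Int.self_sub_floor, ← Int.self_sub_floor]
    push_cast [m]; ring
  have hd : |S - β * m| ≤ δ := by
    have hQ' : β < Q * δ := (div_lt_iff₀ hδ).1 hQ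
    rw [hm, abs_mul, abs_of_pos hβ]
    have : Q * |Int.fract (u ⟨f, hf⟩ k') - Int.fract (u ⟨f, hf⟩ k)| ≤ 1 := by
      rw [← abs_of_nonneg (mul_nonneg hQ0.le (abs_nonneg _)), abs_mul, abs_abs, ← abs_mul, abs_le]
      constructor <;> linarith
    have h3 := mul_le_mul_of_nonneg_left this hδ.le
    have h4 := abs_nonneg (Int.fract (u ⟨f, hf⟩ k') - Int.fract (u ⟨f, hf⟩ k))
    nlinarith
  have hS1 : 1 ≤ S := by
    have hmem : M + k' ∈ Finset.Iic (M + k') \ Finset.Iic (M + k) := by simp [hlt]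
    calc (1 : ℝ) ≤ f (M + k') := by exact_mod_cast (f (M + k')).pos
      _ ≤ S := Finset.single_le_sum (f := fun n => (f n : ℝ)) (fun n _ => by positivity) hmem
  -- The block sum is at least 1 and `δ < 1`, so the nearby multiple of `β` is positive.
  have hm0 : 0 < m := by
    have : 0 < β * m := by linarith [(abs_le.1 hd).2]
    exact_mod_cast pos_of_mul_pos_right this hβ.le
  lift m to ℕ using hm0.le with m' hm'
  refine ⟨⟨m', by exact_mod_cast hm0⟩, ?_⟩
  simpa [← hm'] using hd

/-- Pairwise disjoint blocks along which the sums of each `f ∈ F` are summably close to multiples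
of `β`. -/
theorem exists_seq_block_sum_near (hβ : 0 < β) (F : Finset (ℕ+ → ℕ+)) :
    ∃ (H : ℕ → Finset ℕ+) (φ : (ℕ+ → ℕ+) → ℕ → ℕ+), (∀ n, (H n).Nonempty) ∧
      Pairwise (Function.onFun Disjoint H) ∧
      ∀ f ∈ F, ∀ T : Finset ℕ, |∑ i ∈ T, ((∑ n ∈ H i, (f n : ℝ)) - β * φ f i)| ≤ 1 / 4 := by
  choose M' H hne hsub hφ using fun (M : ℕ+) (n : ℕ) =>
    exists_block_sum_near hβ F M (δ := (1 / 2) ^ n / 8) (by positivity)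
      (by have := pow_le_one₀ (n := n) (by norm_num : (0 : ℝ) ≤ 1 / 2) (by norm_num); linarith)
  let s : ℕ → ℕ+ := fun n => Nat.rec 1 (fun n M => M' M n) n
  have hs : Monotone s := by
    refine monotone_nat_of_le_succ fun n => ?_
    obtain ⟨x, hx⟩ := hne (s n) n
    have := Finset.mem_Ioc.1 (hsub _ _ hx)
    exact (this.1.le.trans this.2 :)
  choose! φ hφ using hφ
  refine ⟨fun n => H (s n) n, fun f n => φ (s n) n f, fun n => hne _ _, fun m n hmn => ?_,
    fun f hf T => ?_⟩
  · have := hs.pairwise_disjoint_on_Ioc_succ hmn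
    refine Finset.disjoint_coe.1 (this.mono ?_ ?_)
    · intro x hx; exact Finset.mem_Ioc.1 (hsub (s m) m hx)
    · intro x hx; exact Finset.mem_Ioc.1 (hsub (s n) n hx)
  · calc |∑ i ∈ T, ((∑ n ∈ H (s i) i, (f n : ℝ)) - β * φ (s i) i f)|
        ≤ ∑ i ∈ T, |(∑ n ∈ H (s i) i, (f n : ℝ)) - β * φ (s i) i f| :=
          Finset.abs_sum_le_sum_abs _ _
      _ ≤ ∑ i ∈ T, (1 / 2 : ℝ) ^ i / 8 := Finset.sum_le_sum fun i _ => hφ _ _ f hf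
      _ = (∑ i ∈ T, (1 / 2 : ℝ) ^ i) / 8 := (Finset.sum_div _ _ _).symm
      _ ≤ 2 / 8 := by
          gcongr
          exact (summable_geometric_two.sum_le_tsum T fun i _ => by positivity).trans_eq
            tsum_geometric_two
      _ = 1 / 4 := by norm_num

theorem J_of_near (hβ : 0 < β) (hA : A ∈ J)
    (h : ∀ x ∈ A, ∃ y ∈ B, |(y : ℝ) - β * x| ≤ C) : B ∈ J := by
  classical
  choose! h hB hd using h
  intro F hF
  have : Nonempty (Fin F.card) := ⟨⟨0, Finset.card_pos.2 hF⟩⟩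
  let ψ : Fin F.card ≃ F := F.equivFin.symm
  obtain ⟨ι, _, hι⟩ := exists_line_oscillation_lt (Fin F.card) C
  obtain ⟨H, φ, hH, hdisj, hφ⟩ := exists_seq_block_sum_near hβ F
  obtain ⟨idx, hidx⟩ := Countable.exists_injective_nat (ℕ+ × ι)
  obtain ⟨D, hD⟩ := exists_nat_gt ((C + 1) / β)
  have hβD : C + 1 < β * D := by rwa [div_lt_iff₀' hβ] at hD
  -- One sequence per word; `idx` gives each pair (index, coordinate) its own block, so the blocks
  -- used later are disjoint. The summand `D + 1` guarantees that the final translate is positive.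
  let G : (ι → Fin F.card) → ℕ+ → ℕ+ := fun w n =>
    ⟨D + 1 + ∑ i, (φ (ψ (w i)) (idx (n, i)) : ℕ), by positivity⟩
  obtain ⟨a, K, hK, hGK⟩ := hA (Finset.univ.image G)
    ⟨G fun _ => Classical.arbitrary _, Finset.mem_image_of_mem _ (Finset.mem_univ _)⟩
  choose x hxA hx using fun w => hGK (G w) (Finset.mem_image_of_mem _ (Finset.mem_univ w))
  obtain ⟨l, hl⟩ := hι (fun w => (h (x w) : ℝ) - β * x w) fun w => hd _ (hxA w)
  obtain ⟨c, hc⟩ := exists_sum_line_eq l fun i v => ∑ n ∈ K, (φ (ψ v) (idx (n, i)) : ℕ)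
  let T : Finset ℕ := (K ×ˢ activeCoords l).map ⟨idx, hidx⟩
  have hT : T.Nonempty := (hK.product (activeCoords_nonempty l)).map
  let U : Finset ℕ+ := T.biUnion H
  have hU : U.Nonempty := hT.biUnion fun i _ => hH i
  have hxl : ∀ v, (x (l v) : ℕ) = a + (K.card * (D + 1) + c + ∑ i ∈ T, (φ (ψ v) i : ℕ)) := by
    intro v
    rw [hx]
    simp only [G, PNat.mk_coe, Finset.sum_add_distrib, Finset.sum_const, smul_eq_mul]
    rw [Finset.sum_comm, hc, Finset.sum_map, Finset.sum_product_right]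
    simp only [Function.Embedding.coeFn_mk]
    ring
  have hUf : ∀ f : ℕ+ → ℕ+, (∑ n ∈ U, (f n : ℝ)) = ∑ i ∈ T, ∑ n ∈ H i, (f n : ℝ) := fun f =>
    Finset.sum_biUnion fun i _ j _ hij => hdisj hij
  have hnear : ∀ v, |(∑ n ∈ U, ((ψ v : ℕ+ → ℕ+) n : ℝ)) - β * ∑ i ∈ T, (φ (ψ v) i : ℝ)|
      ≤ 1 / 4 := by
    intro v
    rw [hUf, Finset.mul_sum, ← Finset.sum_sub_distrib]
    exact hφ _ (ψ v).2 T
  have hxl' : ∀ v, (x (l v) : ℝ) = a + K.card * (D + 1) + c + ∑ i ∈ T, (φ (ψ v) i : ℝ) := by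
    intro v
    have := congrArg (Nat.cast (R := ℝ)) (hxl v)
    push_cast at this
    linarith
  -- The candidate translate. Along the line it varies by less than 1/4 from oscillation plus twice
  -- 1/4 from the block errors, so as an integer it is constant.
  let z : Fin F.card → ℤ := fun v => (h (x (l v)) : ℕ) - ∑ n ∈ U, (((ψ v : ℕ+ → ℕ+) n : ℕ) : ℤ)
  have hz : ∀ v, (z v : ℝ) = h (x (l v)) - ∑ n ∈ U, ((ψ v : ℕ+ → ℕ+) n : ℝ) := by
    intro v; simp [z]
  have hzc : ∀ v w, z v = z w := by
    intro v w
    have e1 := abs_lt.1 (hl v w)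
    have e2 := abs_le.1 (hnear v)
    have e3 := abs_le.1 (hnear w)
    rw [hxl', hxl'] at e1
    have : |(z v : ℝ) - z w| < 1 := by
      rw [hz, hz, abs_lt]
      constructor <;> linarith
    have : |z v - z w| < 1 := by exact_mod_cast this
    exact sub_eq_zero.1 (Int.abs_lt_one_iff.1 this)
  let v₀ : Fin F.card := Classical.arbitrary _
  have hz0 : 0 < z v₀ := by
    have e1 := abs_le.1 (hd _ (hxA (l v₀)))
    have e2 := abs_le.1 (hnear v₀)
    rw [hxl'] at e1
    have hK1 : (1 : ℝ) ≤ K.card := by exact_mod_cast hK.card_pos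
    have e3 : β * D ≤ β * (a + K.card * (D + 1) + c) := by
      apply mul_le_mul_of_nonneg_left _ hβ.le
      have : (0 : ℝ) ≤ D := D.cast_nonneg
      have : (0 : ℝ) < a := by exact_mod_cast a.pos
      have : (0 : ℝ) ≤ c := c.cast_nonneg
      nlinarith
    have : (0 : ℝ) < z v₀ := by rw [hz]; linarith
    exact_mod_cast this
  obtain ⟨b, hb⟩ := Int.eq_ofNat_of_zero_le hz0.le
  refine ⟨⟨b, by omega⟩, U, hU, fun f hf => ?_⟩
  obtain ⟨v, hv⟩ := ψ.surjective ⟨f, hf⟩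
  refine ⟨h (x (l v)), hB _ (hxA _), ?_⟩
  have e1 := hzc v v₀
  rw [hb] at e1
  simp only [z, hv] at e1
  simp only [PNat.mk_coe]
  zify
  linarith

/-! ### Upper asymptotic and upper Banach density -/

open Filter

theorem limsup_pos_iff_of_mem_Icc {ι : Type*} {f : Filter ι} {u : ι → ℝ}
    (hu : ∀ᶠ i in f, u i ∈ Set.Icc (0 : ℝ) 1) :
    0 < limsup u f ↔ ∃ ε > 0, ∃ᶠ i in f, ε ≤ u i := by
  rcases f.eq_or_neBot with rfl | hf
  -- On `⊥` the real limsup is `sInf univ = 0`, so both sides are false.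
  · simp [limsup, limsSup]
  have hle : f.IsBoundedUnder (· ≤ ·) u := ⟨1, eventually_map.2 (hu.mono fun _ h => h.2)⟩
  have hge : f.IsBoundedUnder (· ≥ ·) u := ⟨0, eventually_map.2 (hu.mono fun _ h => h.1)⟩
  constructor
  · intro h
    obtain ⟨ε, hε, hε'⟩ := exists_between h
    exact ⟨ε, hε, (frequently_lt_of_lt_limsup hge.isCoboundedUnder_le hε').mono fun _ => le_of_lt⟩
  · rintro ⟨ε, hε, h⟩
    exact hε.trans_le (le_limsup_of_frequently_le h hle)

theorem ncard_inter_Icc_le (A : Set ℕ+) (n : ℕ+) : (A ∩ Set.Icc 1 n).ncard ≤ n := by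
  calc (A ∩ Set.Icc 1 n).ncard ≤ (Set.Icc 1 n).ncard :=
        Set.ncard_le_ncard Set.inter_subset_right (Set.finite_Icc 1 n)
    _ = n := by rw [← Finset.coe_Icc, Set.ncard_coe_finset, PNat.card_Icc]; simp

theorem mem_PUAD_iff : A ∈ PUAD ↔
    ∃ ε : ℝ, 0 < ε ∧ ∀ N : ℕ+, ∃ n ≥ N, ε * n ≤ (A ∩ Set.Icc 1 n).ncard := by
  rw [PUAD, Set.mem_ofPred_eq, upperDensity, limsup_pos_iff_of_mem_Icc]
  · simp_rw [frequently_atTop, gt_iff_lt]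
    refine exists_congr fun ε => and_congr_right fun _ => forall_congr' fun N =>
      exists_congr fun n => and_congr_right fun _ => ?_
    rw [le_div_iff₀ (by exact_mod_cast n.pos)]
  · refine Eventually.of_forall fun n => ⟨by positivity, div_le_one_of_le₀ ?_ (by positivity)⟩
    exact_mod_cast ncard_inter_Icc_le A n

theorem ncard_inter_Ioc_le (A : Set ℕ+) (n m : ℕ+) :
    (A ∩ Set.Ioc n m).ncard ≤ (m : ℕ) - n := by
  calc (A ∩ Set.Ioc n m).ncard ≤ (Set.Ioc n m).ncard :=
        Set.ncard_le_ncard Set.inter_subset_right (Set.finite_Ioc n m)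
    _ = m - n := by rw [← Finset.coe_Ioc, Set.ncard_coe_finset, PNat.card_Ioc]

theorem mem_PUBD_iff : A ∈ PUBD ↔
    ∃ ε : ℝ, 0 < ε ∧ ∀ R : ℝ, ∃ n m : ℕ+, R ≤ (m : ℝ) - n ∧
      ε * ((m : ℝ) - n) ≤ (A ∩ Set.Ioc n m).ncard := by
  have hbasis := (atTop_basis (α := ℝ)).comap fun q : ℕ+ × ℕ+ => (q.2 : ℝ) - (q.1 : ℝ)
  have hpos : ∀ᶠ q : ℕ+ × ℕ+ in comap (fun q : ℕ+ × ℕ+ => (q.2 : ℝ) - (q.1 : ℝ)) atTop,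
      0 < (q.2 : ℝ) - q.1 := tendsto_comap.eventually (eventually_gt_atTop 0)
  rw [PUBD, Set.mem_ofPred_eq, upperBanachDensity, limsup_pos_iff_of_mem_Icc]
  · refine exists_congr fun ε => and_congr_right fun _ => ?_
    have : (∃ᶠ q : ℕ+ × ℕ+ in comap (fun q : ℕ+ × ℕ+ => (q.2 : ℝ) - (q.1 : ℝ)) atTop,
        ε ≤ ((A ∩ Set.Ioc q.1 q.2).ncard : ℝ) / ((q.2 : ℝ) - (q.1 : ℝ))) ↔
        ∃ᶠ q : ℕ+ × ℕ+ in comap (fun q : ℕ+ × ℕ+ => (q.2 : ℝ) - (q.1 : ℝ)) atTop,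
        ε * ((q.2 : ℝ) - q.1) ≤ (A ∩ Set.Ioc q.1 q.2).ncard :=
      frequently_congr (hpos.mono fun q hq => le_div_iff₀ hq)
    rw [this, hbasis.frequently_iff]
    simp
  · refine hpos.mono fun q hq => ⟨div_nonneg (by positivity) hq.le, div_le_one_of_le₀ ?_ hq.le⟩
    have h1 : (q.1 : ℕ) ≤ q.2 := by
      have : (q.1 : ℝ) ≤ q.2 := by linarith
      exact_mod_cast this
    rw [← Nat.cast_sub h1]
    exact_mod_cast ncard_inter_Ioc_le A q.1 q.2

/-- Counting along a map whose fibres have bounded size. -/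
theorem ncard_le_mul_ncard_of_mapsTo (hβ : 0 < β) {h : ℕ+ → ℕ+} {S T : Set ℕ+}
    (hS : S.Finite) (hT : T.Finite) (hST : ∀ x ∈ S, h x ∈ T)
    (hd : ∀ x ∈ S, |((h x : ℕ+) : ℝ) - β * x| ≤ C) :
    S.ncard ≤ (⌊2 * C / β⌋₊ + 1) * T.ncard := by
  rw [Set.ncard_eq_toFinset_card S hS, Set.ncard_eq_toFinset_card T hT]
  refine (card_le_mul_card_image_of_abs_sub_le hβ hS.toFinset fun x hx =>
    hd x (hS.mem_toFinset.1 hx)).trans (Nat.mul_le_mul_left _ (Finset.card_le_card ?_))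
  intro y hy
  obtain ⟨x, hx, rfl⟩ := Finset.mem_image.1 hy
  exact hT.mem_toFinset.2 (hST x (hS.mem_toFinset.1 hx))

theorem PUAD_of_near (hβ : 0 < β) (hC : 0 ≤ C) (hA : A ∈ PUAD)
    (h : ∀ x ∈ A, ∃ y ∈ B, |(y : ℝ) - β * x| ≤ C) : B ∈ PUAD := by
  choose! h hB hd using h
  rw [mem_PUAD_iff] at hA ⊢
  obtain ⟨ε, hε, hA⟩ := hA
  set D : ℕ+ := ⟨⌈β + C⌉₊, Nat.ceil_pos.2 (by positivity)⟩
  have hD : β + C ≤ D := Nat.le_ceil _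
  have hD1 : (1 : ℝ) ≤ D := by exact_mod_cast D.pos
  set K : ℕ := ⌊2 * C / β⌋₊ + 1
  have hK : (0 : ℝ) < K := by positivity
  refine ⟨ε / (K * D), by positivity, fun N => ?_⟩
  obtain ⟨n, hn, hcard⟩ := hA N
  refine ⟨D * n, hn.trans ?_, ?_⟩
  · exact le_mul_of_one_le_left' one_le
  have hcount := ncard_le_mul_ncard_of_mapsTo (S := A ∩ Set.Icc 1 n)
    (T := B ∩ Set.Icc 1 (D * n)) hβ ((Set.finite_Icc 1 n).inter_of_right A)
    ((Set.finite_Icc 1 _).inter_of_right B) (fun x hx => ⟨hB x hx.1, one_le, ?_⟩)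
    (fun x hx => hd x hx.1)
  · have h1 : (ε * n : ℝ) ≤ K * (B ∩ Set.Icc 1 (D * n)).ncard :=
      hcard.trans (by exact_mod_cast hcount)
    rw [PNat.mul_coe, Nat.cast_mul]
    calc ε / (K * D) * (D * n : ℝ) = ε * n / K := by field_simp
      _ ≤ _ := by rwa [div_le_iff₀' hK]
  · have h1 := (abs_le.1 (hd x hx.1)).2
    have hx1 : (1 : ℝ) ≤ x := by exact_mod_cast x.pos
    have hxn : (x : ℝ) ≤ n := by exact_mod_cast hx.2.2
    have : (h x : ℝ) ≤ D * n := by nlinarith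
    exact_mod_cast this

theorem PUBD_of_near (hβ : 0 < β) (hC : 0 ≤ C) (hA : A ∈ PUBD)
    (h : ∀ x ∈ A, ∃ y ∈ B, |(y : ℝ) - β * x| ≤ C) : B ∈ PUBD := by
  choose! h hB hd using h
  rw [mem_PUBD_iff] at hA ⊢
  obtain ⟨ε, hε, hA⟩ := hA
  set K : ℕ := ⌊2 * C / β⌋₊ + 1
  have hK : (0 : ℝ) < K := by positivity
  have hD : 0 < β + 2 * C + 3 := by positivity
  refine ⟨ε / (2 * K * (β + 2 * C + 3)), by positivity, fun R => ?_⟩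
  -- The three bounds make the new window long, absorb the extra point 1 inserted below, and let `m
  -- - n ≥ 1` absorb additive constants.
  obtain ⟨n, m, hnm, hcard⟩ := hA (max (max ((R + 1) / β) (2 * K / ε)) 1)
  simp only [max_le_iff] at hnm
  obtain ⟨⟨hR, hKε⟩, h1⟩ := hnm
  rw [div_le_iff₀' hβ] at hR
  rw [div_le_iff₀' hε] at hKε
  have hm0 : (0 : ℝ) < m := by exact_mod_cast m.pos
  have hn0 : (0 : ℝ) < n := by exact_mod_cast n.pos
  set n' : ℕ+ := ⟨max (⌊β * n - C⌋₊ - 1) 1, by positivity⟩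
  set m' : ℕ+ := ⟨⌈β * m + C⌉₊, Nat.ceil_pos.2 (by positivity)⟩
  have hm'1 : β * m + C ≤ m' := Nat.le_ceil _
  have hm'2 : (m' : ℝ) < β * m + C + 1 := Nat.ceil_lt_add_one (by positivity)
  have hn'c : (n' : ℕ) = max (⌊β * n - C⌋₊ - 1) 1 := rfl
  have hn'1 : (n' : ℝ) ≤ β * n + 1 := by
    rcases le_total (⌊β * n - C⌋₊ - 1) 1 with hc | hc
    · rw [hn'c, max_eq_right hc]
      have := mul_pos hβ hn0
      push_cast; linarith
    · rw [hn'c, max_eq_left hc]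
      have h2 : ((⌊β * n - C⌋₊ - 1 : ℕ) : ℝ) ≤ ⌊β * n - C⌋₊ := by
        exact_mod_cast Nat.sub_le _ _
      have h3 : (⌊β * n - C⌋₊ : ℝ) ≤ β * n - C := by
        refine Nat.floor_le (le_of_not_gt fun h4 => ?_)
        rw [Nat.floor_of_nonpos h4.le] at hc
        omega
      linarith
  have hn'2 : β * n - C - 2 ≤ n' := by
    have h2 : ⌊β * n - C⌋₊ ≤ (n' : ℕ) + 1 := by omega
    have h3 : (⌊β * n - C⌋₊ : ℝ) ≤ (n' : ℝ) + 1 := by exact_mod_cast h2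
    linarith [Nat.lt_floor_add_one (β * n - C)]
  refine ⟨n', m', by linarith, ?_⟩
  have hfin : (B ∩ Set.Ioc n' m').Finite := (Set.finite_Ioc _ _).inter_of_right B
  -- The left endpoint `n'` cannot go below 1, so the window may miss the value 1; it is added by
  -- hand.
  have hcount := ncard_le_mul_ncard_of_mapsTo (S := A ∩ Set.Ioc n m)
    (T := insert 1 (B ∩ Set.Ioc n' m')) hβ ((Set.finite_Ioc n m).inter_of_right A)
    (hfin.insert 1) (fun x hx => ?_) (fun x hx => hd x hx.1)
  · have h2 : (A ∩ Set.Ioc n m).ncard ≤ K * ((B ∩ Set.Ioc n' m').ncard + 1) :=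
      hcount.trans (Nat.mul_le_mul_left _ (Set.ncard_insert_le _ _))
    have h3 : (ε * (m - n) : ℝ) ≤ K * ((B ∩ Set.Ioc n' m').ncard + 1) :=
      hcard.trans (by exact_mod_cast h2)
    have h4 : (m' : ℝ) - n' ≤ (β + 2 * C + 3) * (m - n) := by nlinarith
    calc ε / (2 * K * (β + 2 * C + 3)) * ((m' : ℝ) - n')
        ≤ ε / (2 * K * (β + 2 * C + 3)) * ((β + 2 * C + 3) * (m - n)) := by gcongr
      _ = ε * (m - n) / (2 * K) := by field_simp
      _ ≤ _ := by
        rw [div_le_iff₀ (by positivity)]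
        linarith
  · have h2 := abs_le.1 (hd x hx.1)
    have hxn : (n : ℝ) + 1 ≤ x := by exact_mod_cast hx.2.1
    have hxm : (x : ℝ) ≤ m := by exact_mod_cast hx.2.2
    rw [Set.mem_insert_iff, or_iff_not_imp_left]
    intro hne
    refine ⟨hB x hx.1, ?_, ?_⟩
    · rw [← PNat.coe_lt_coe, hn'c]
      have hx1 : 1 < (h x : ℕ) := by
        have := (h x).pos
        have : (h x : ℕ) ≠ 1 := fun h => hne (PNat.eq h)
        omega
      have h5 : ⌊β * n - C⌋₊ ≤ (h x : ℕ) := Nat.floor_le_of_le (by nlinarith)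
      omega
    · have : (h x : ℝ) ≤ m' := by nlinarith
      exact_mod_cast this

/-! ### The seven families together -/

theorem mem_of_near {𝓕 : Set (Set ℕ+)}
    (h𝓕 : 𝓕 ∈ ({IF, AP, PS, HSD, J, PUAD, PUBD} : Set (Set (Set ℕ+))))
    (hβ : 0 < β) (hC : 0 ≤ C) (hA : A ∈ 𝓕)
    (h : ∀ x ∈ A, ∃ y ∈ B, |(y : ℝ) - β * x| ≤ C) : B ∈ 𝓕 := by
  simp only [Set.mem_insert_iff, Set.mem_singleton_iff] at h𝓕
  rcases h𝓕 with rfl | rfl | rfl | rfl | rfl | rfl | rfl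
  · exact IF_of_near hβ hA h
  · exact AP_of_near hβ hA h
  · exact PS_of_near hβ hC hA h
  · exact HSD_of_near hβ hC hA h
  · exact J_of_near hβ hA h
  · exact PUAD_of_near hβ hC hA h
  · exact PUBD_of_near hβ hC hA h

/-- Used to keep 0 out of the image ultrafilters: the set where `g` vanishes, dilated by `α`, stays
near `{1}`. -/
theorem singleton_one_notMem {𝓕 : Set (Set ℕ+)}
    (h𝓕 : 𝓕 ∈ ({IF, AP, PS, HSD, J, PUAD, PUBD} : Set (Set (Set ℕ+)))) : {1} ∉ 𝓕 := by
  have hone : ∀ S : Set ℕ+, (({1} : Set ℕ+) ∩ S).ncard ≤ 1 := fun S =>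
    (Set.ncard_le_ncard Set.inter_subset_left).trans (Set.ncard_singleton _).le
  simp only [Set.mem_insert_iff, Set.mem_singleton_iff] at h𝓕
  rcases h𝓕 with rfl | rfl | rfl | rfl | rfl | rfl | rfl
  · exact fun h => h (Set.finite_singleton 1)
  · intro h
    obtain ⟨a, d, had⟩ := h 2
    obtain ⟨x, hx, hxa⟩ := had 1 (by norm_num)
    rw [Set.mem_singleton_iff.1 hx, PNat.one_coe] at hxa
    have := a.pos
    have := d.pos
    omega
  · rintro ⟨G, -, hG⟩
    obtain ⟨x, hx⟩ := hG {1} (Finset.singleton_nonempty 1)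
    have := hx 1 (Finset.mem_singleton_self 1)
    simp only [Set.mem_iUnion, Set.mem_ofPred_eq, Set.mem_singleton_iff, exists_prop] at this
    obtain ⟨t, -, ht⟩ := this
    have ht' := congrArg ((↑) : ℕ+ → ℕ) ht
    simp only [PNat.add_coe, PNat.one_coe] at ht'
    have := t.pos
    omega
  · intro h
    rw [HSD, Set.mem_ofPred_eq, tsum_fintype] at h
    simp at h
  · intro h
    obtain ⟨a, H, hH, hf⟩ := h {fun _ => 1} (Finset.singleton_nonempty _)
    obtain ⟨x, hx, hxa⟩ := hf _ (Finset.mem_singleton_self _)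
    rw [Set.mem_singleton_iff.1 hx] at hxa
    simp only [PNat.one_coe, Finset.sum_const, smul_eq_mul, mul_one] at hxa
    have := a.pos
    have := hH.card_pos
    omega
  · rw [mem_PUAD_iff]
    rintro ⟨ε, hε, h⟩
    obtain ⟨N, hN⟩ := exists_nat_gt (1 / ε)
    rw [div_lt_iff₀' hε] at hN
    obtain ⟨n, hn, hcard⟩ := h N.succPNat
    have h1 : (N : ℝ) + 1 ≤ n := by exact_mod_cast hn
    have h2 : ((({1} : Set ℕ+) ∩ Set.Icc 1 n).ncard : ℝ) ≤ 1 := by exact_mod_cast hone _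
    nlinarith
  · rw [mem_PUBD_iff]
    rintro ⟨ε, hε, h⟩
    obtain ⟨n, m, hnm, hcard⟩ := h (2 / ε)
    rw [div_le_iff₀' hε] at hnm
    have h2 : ((({1} : Set ℕ+) ∩ Set.Ioc n m).ncard : ℝ) ≤ 1 := by exact_mod_cast hone _
    linarith

/-! ### The right inverse of `g` and the passage to ultrafilters -/

/-- The least `n` with `m ≤ ⌊α n + γ⌋`. -/
noncomputable def sect (α γ : ℝ) (m : ℕ+) : ℕ+ := ⌈((m : ℝ) - γ) / α⌉₊.toPNat'

variable {α γ : ℝ}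

theorem coe_sect (hα₀ : 0 < α) (hγ₁ : γ < 1) (m : ℕ+) :
    ((sect α γ m : ℕ+) : ℕ) = ⌈((m : ℝ) - γ) / α⌉₊ := by
  have hm : (1 : ℝ) ≤ m := by exact_mod_cast m.pos
  rw [sect, Nat.toPNat'_coe, if_pos]
  exact Nat.ceil_pos.2 (div_pos (by linarith) hα₀)

theorem le_sect (hα₀ : 0 < α) (hγ₁ : γ < 1) (m : ℕ+) : (m : ℝ) ≤ α * sect α γ m + γ := by
  have := Nat.le_ceil (((m : ℝ) - γ) / α)
  rw [div_le_iff₀' hα₀] at this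
  rw [coe_sect hα₀ hγ₁]
  linarith

theorem sect_lt (hα₀ : 0 < α) (hγ₁ : γ < 1) (m : ℕ+) :
    α * sect α γ m + γ < m + α := by
  have hm : (1 : ℝ) ≤ m := by exact_mod_cast m.pos
  have := Nat.ceil_lt_add_one (a := ((m : ℝ) - γ) / α) (div_nonneg (by linarith) hα₀.le)
  rw [← coe_sect hα₀ hγ₁, ← sub_lt_iff_lt_add, lt_div_iff₀' hα₀] at this
  linarith

/-- With `α ≤ 1`, the first time `α n + γ` reaches `m` it overshoots by less than 1, so no positive
integer is skipped. -/
theorem g_sect (hα₀ : 0 < α) (hα₁ : α ≤ 1) (hγ₁ : γ < 1) (m : ℕ+) :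
    g α γ (sect α γ m) = m := by
  have h1 := le_sect hα₀ hγ₁ m
  have h2 := sect_lt hα₀ hγ₁ m
  rw [g, Nat.floor_eq_iff ((Nat.cast_nonneg _).trans h1)]
  exact ⟨h1, by linarith⟩

theorem abs_g_sub_le (hα₀ : 0 < α) (hγ₀ : 0 < γ) (hγ₁ : γ < 1) (n : ℕ+) :
    |(g α γ n : ℝ) - α * n| ≤ 1 := by
  have h0 : 0 ≤ α * n + γ := by positivity
  have h1 := Nat.floor_le h0
  have h2 := Nat.lt_floor_add_one (α * n + γ)
  rw [g, abs_le]
  constructor <;> linarith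

theorem abs_sect_sub_le (hα₀ : 0 < α) (hα₁ : α ≤ 1) (hγ₀ : 0 < γ) (hγ₁ : γ < 1) (m : ℕ+) :
    |(sect α γ m : ℝ) - α⁻¹ * m| ≤ α⁻¹ := by
  have h1 := le_sect hα₀ hγ₁ m
  have h2 := sect_lt hα₀ hγ₁ m
  have h3 : α * |(sect α γ m : ℝ) - α⁻¹ * m| ≤ 1 := by
    rw [← abs_of_nonneg (mul_nonneg hα₀.le (abs_nonneg _)), abs_mul, abs_abs, ← abs_mul, mul_sub,
      mul_inv_cancel_left₀ hα₀.ne', abs_le]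
    constructor <;> linarith
  rwa [← div_eq_inv_mul, ← one_div, le_div_iff₀' hα₀, div_eq_inv_mul]

theorem gTilde_map_sect (hα₀ : 0 < α) (hα₁ : α ≤ 1) (hγ₁ : γ < 1) (q : Ultrafilter ℕ+) :
    gTilde α γ (q.map (sect α γ)) = incl q := by
  rw [gTilde, incl, Ultrafilter.map_map]
  congr 1
  exact funext fun m => g_sect hα₀ hα₁ hγ₁ m

/-- An ultrafilter on `ℕ` not containing `{0}` comes from the positive integers. -/
theorem exists_incl_eq {r : Ultrafilter ℕ} (hr : {0} ∉ r) : ∃ q, incl q = r := by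
  have hrange : Set.range (fun n : ℕ+ => (n : ℕ)) ∈ r := by
    refine Filter.mem_of_superset (Ultrafilter.compl_mem_iff_notMem.2 hr) fun n hn => ?_
    exact ⟨⟨n, Nat.pos_of_ne_zero hn⟩, rfl⟩
  refine ⟨r.comap PNat.coe_injective hrange, ?_⟩
  ext S
  rw [incl, Ultrafilter.mem_map, Ultrafilter.mem_comap, Set.image_preimage_eq_inter_range]
  exact ⟨fun h => Filter.mem_of_superset h Set.inter_subset_left,
    fun h => Filter.inter_mem h hrange⟩

end NonhomSpectra

open NonhomSpectra in
theorem mainTheorem12 (α γ : ℝ) (hα₀ : 0 < α) (hα₁ : α ≤ 1) (hγ₀ : 0 < γ) (hγ₁ : γ < 1)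
    (𝓕 : Set (Set ℕ+))
    (h𝓕 : 𝓕 ∈ ({NonhomSpectra.IF, NonhomSpectra.AP, NonhomSpectra.PS, NonhomSpectra.HSD,
      NonhomSpectra.J, NonhomSpectra.PUAD, NonhomSpectra.PUBD} : Set (Set (Set ℕ+)))) :
    NonhomSpectra.gTilde α γ '' NonhomSpectra.beta 𝓕 =
        NonhomSpectra.incl '' NonhomSpectra.beta 𝓕 ∧
      ∀ E ∈ NonhomSpectra.dual 𝓕,
        {m : ℕ+ | (m : ℕ) ∈ NonhomSpectra.g α γ '' E} ∈ NonhomSpectra.dual 𝓕 := by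
  refine ⟨Set.Subset.antisymm ?_ ?_, fun E hE B hB => ?_⟩
  · rintro _ ⟨p, hp, rfl⟩
    have hzero : {0} ∉ gTilde α γ p := fun h0 => by
      refine singleton_one_notMem h𝓕 (mem_of_near h𝓕 hα₀ zero_le_two (hp _ h0) fun x hx => ?_)
      have h1 := abs_le.1 (abs_g_sub_le hα₀ hγ₀ hγ₁ x)
      have h2 : g α γ x = 0 := hx
      have h3 : 0 < α * x := mul_pos hα₀ (by exact_mod_cast x.pos)
      rw [h2] at h1
      push_cast at h1
      refine ⟨1, rfl, abs_le.2 ⟨?_, ?_⟩⟩ <;> push_cast <;> linarith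
    obtain ⟨q, hq⟩ := exists_incl_eq hzero
    refine ⟨q, fun B hB => ?_, hq⟩
    have hB' : (fun n : ℕ+ => (n : ℕ)) '' B ∈ gTilde α γ p := by
      rw [← hq, incl, Ultrafilter.mem_map, Set.preimage_image_eq B PNat.coe_injective]
      exact hB
    refine mem_of_near h𝓕 hα₀ zero_le_one (hp _ hB') ?_
    rintro x ⟨y, hy, hyx⟩
    refine ⟨y, hy, ?_⟩
    have := abs_g_sub_le hα₀ hγ₀ hγ₁ x
    rwa [← hyx] at this
  · rintro _ ⟨q, hq, rfl⟩
    refine ⟨q.map (sect α γ), fun A hA => ?_, gTilde_map_sect hα₀ hα₁ hγ₁ q⟩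
    exact mem_of_near h𝓕 (inv_pos.2 hα₀) (inv_pos.2 hα₀).le (hq _ hA) fun m hm =>
      ⟨sect α γ m, hm, abs_sect_sub_le hα₀ hα₁ hγ₀ hγ₁ m⟩
  · have hpre : {n : ℕ+ | ∃ m ∈ B, g α γ n = m} ∈ 𝓕 :=
      mem_of_near h𝓕 (inv_pos.2 hα₀) (inv_pos.2 hα₀).le hB fun m hm =>
        ⟨sect α γ m, ⟨m, hm, g_sect hα₀ hα₁ hγ₁ m⟩, abs_sect_sub_le hα₀ hα₁ hγ₀ hγ₁ m⟩
    obtain ⟨n, hnE, m, hm, hnm⟩ := hE _ hpre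
    exact ⟨m, ⟨n, hnE, hnm⟩, hm⟩
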